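/- Let $F$ be a field, let $m\ge 0$ be an integer and let $A\in\mathfrak{gl}(m,F)=M_m(F)$. Write $\mathrm{ad}\,A$ for the $F$-linear operator $B\mapsto AB-BA$ on $M_m(F)$. Then the conditions (C1) all eigenvalues of $\mathrm{ad}\,A$ (in an algebraic closure of $F$) lie in $F$, (C2) the eigenvalues of $\mathrm{ad}\,A$ form a subfield of $F$, (C3) the centralizer of $A$ in $M_m(F)$ is a field, all hold if and only if the following three conditions all hold: (C4) $F$ has prime characteristic $p$, (C5) $A$ is similar to the companion matrix of a monic irreducible polynomial $h\in F[X]$ of degree $m$, (C6) if $q\in F[X]$ is the separable part of $h$, i.e. $q$ is separable and $h(X)=q(X^{p^e})$ with $e\ge 0$, then $q=X^{p^n}-X-a$ for some $a\in F$ and $n\ge 1$ such that $F$ contains a subfield $\mathbb F_{p^n}$ with $p^n$ elements. Moreover, if (C4)-(C6) hold, with $p$, $h$, $q$, $e$, $n$, $a$ as there, then: - $q$ is irreducible; - the set of eigenvalues of $\mathrm{ad}\,A$ is precisely the subfield $\mathbb F_{p^n}$ of $F$; - all eigenvectors of $\mathrm{ad}\,A$ are invertible in $M_m(F)$; - all eigenspaces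 of $\mathrm{ad}\,A$ have dimension $p^{n+e}$ over $F$; - $\mathrm{ad}\,A$ is diagonalizable over $F$ if and only if $h$ is separable, equivalently if and only if $e=0$; - the invariant factors of $\mathrm{ad}\,A$ are $X^{p^{n+e}}-X^{p^e},\dots,X^{p^{n+e}}-X^{p^e}$, with multiplicity $p^{n+e}$; that is, $M_m(F)$, viewed as an $F[X]$-module with $X$ acting as $\mathrm{ad}\,A$, is isomorphic to the direct sum of $p^{n+e}$ copies of $F[X]/(X^{p^{n+e}}-X^{p^e})$; - in particular, the minimal polynomial of $\mathrm{ad}\,A$ is $X^{p^{n+e}}-X^{p^e}$. -/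

import Mathlib

open Polynomial

noncomputable section

/-- The operator `ad A : gl(m, F) → gl(m, F)`, `B ↦ A * B - B * A`. -/
def adMat {F : Type*} [Field F] {m : ℕ} (A : Matrix (Fin m) (Fin m) F) :
    Module.End F (Matrix (Fin m) (Fin m) F) :=
  LinearMap.mulLeft F A - LinearMap.mulRight F A

/-- The `m × m` companion matrix of a polynomial `g` (meant for `g` monic of degree `m`):
ones just below the diagonal, last column `-g₀, …, -g_{m-1}`, zeros elsewhere. -/
def companionMat {F : Type*} [Field F] (m : ℕ) (g : F[X]) : Matrix (Fin m) (Fin m) F :=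
  Matrix.of fun i j =>
    if (j : ℕ) + 1 = m then -g.coeff i else if (i : ℕ) = (j : ℕ) + 1 then 1 else 0

/-- Similarity of square matrices: `B = P⁻¹ * A * P` for an invertible `P`. -/
def MatSimilar {F : Type*} [Field F] {m : ℕ} (A B : Matrix (Fin m) (Fin m) F) : Prop :=
  ∃ P : (Matrix (Fin m) (Fin m) F)ˣ, B = (P⁻¹).val * A * P.val

/-- All eigenvalues of the endomorphism `f`, taken in an algebraic closure of `F`
(that is, the eigenvalues of `f` after extension of scalars), lie in `F`. -/
def AllEigenvaluesIn {F V : Type*} [Field F] [AddCommGroup V] [Module F V]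
    (f : Module.End F V) : Prop :=
  ∀ μ : AlgebraicClosure F,
    Module.End.HasEigenvalue (LinearMap.baseChange (AlgebraicClosure F) f) μ →
      ∃ b : F, algebraMap F (AlgebraicClosure F) b = μ

/-- The set of eigenvalues in `F` of an endomorphism. -/
def eigenvalueSet {F V : Type*} [Field F] [AddCommGroup V] [Module F V]
    (f : Module.End F V) : Set F :=
  {b | Module.End.HasEigenvalue f b}

/-- An endomorphism is diagonalizable if there is a basis consisting of eigenvectors
(indexed by some set `s` of vectors). -/
def IsDiagonalizableEnd {F V : Type*} [Field F] [AddCommGroup V] [Module F V]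
    (f : Module.End F V) : Prop :=
  ∃ (s : Set V) (b : Module.Basis s F V), ∀ i : s, ∃ c : F, f (b i) = c • b i

/-- `d 0 ∣ d 1 ∣ ⋯ ∣ d (k - 1)` are the invariant factors of the endomorphism `f`: they are monic
and nonconstant, each divides the next, and `V`, viewed as an `F[X]`-module with `X` acting
as `f`, is isomorphic to the product of the cyclic modules `F[X] / (d i)`. -/
structure HasInvariantFactors {F V : Type*} [Field F] [AddCommGroup V] [Module F V]
    (f : Module.End F V) {k : ℕ} (d : Fin k → F[X]) : Prop where
  monic : ∀ i, (d i).Monic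
  natDegree_pos : ∀ i, 0 < (d i).natDegree
  dvd : ∀ i j, i ≤ j → d i ∣ d j
  equiv : Nonempty (Module.AEval' f ≃ₗ[F[X]] ((i : Fin k) → F[X] ⧸ Ideal.span {d i}))

/-- `q` is the separable part of `h` with exponent `e`: `h(X) = q(X ^ (p ^ e))`,
where `q` is separable. -/
structure IsSeparablePart {F : Type*} [Field F] (p : ℕ) (h q : F[X]) (e : ℕ) : Prop where
  separable : q.Separable
  expand_eq : h = expand F (p ^ e) q

/-- `F` has prime characteristic `p`; the matrix `A` is similar to the companion matrix of the
monic irreducible polynomial `h` of degree `m`; the separable part `q` of `h`, with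
`h(X) = q(X ^ (p ^ e))`, is `X ^ (p ^ n) - X - a` with `n ≥ 1`; and `K` is a
subfield of `F` with `p ^ n` elements. -/
structure IsGenArtinSchreier {F : Type*} [Field F] {m : ℕ} (A : Matrix (Fin m) (Fin m) F)
    (p : ℕ) (h q : F[X]) (e n : ℕ) (a : F) (K : Subfield F) : Prop where
  prime : p.Prime
  charP : CharP F p
  monic : h.Monic
  irreducible : Irreducible h
  natDegree_eq : h.natDegree = m
  similar : MatSimilar A (companionMat m h)
  sepPart : IsSeparablePart p h q e
  one_le : 1 ≤ n
  q_eq : q = X ^ (p ^ n) - X - C a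
  card_eq : Nat.card K = p ^ n

end

/-! The equation `ad A B = c B` says `A B = B (A + c)`: eigenvectors intertwine `A` with its
translates. If an irreducible `h` of degree `m` kills `A`, then `F^m` is a line over `F[X]/(h)`, so
nonzero intertwiners are invertible (`isUnit_of_mul_eq_mul`) and the eigenvalues of `ad A` are the
`c` with `h(X + c) = h`. A centralizer that is a field forces this situation
(`irreducible_minpoly_of_isField_centralizer`).

In characteristic `p`, `(ad A)^(p^i) = ad (A^(p^i))`. If all eigenvalues lie in `F` and form a
subfield, it is finite, with `p^n` elements, and some `(X^(p^n) - X)^(p^k)` kills `ad A`; hence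
`A^(p^(n+k)) - A^(p^k)` is central, so scalar. This confines the roots of `q` to those of one
polynomial `X^(p^n) - X - const`, while translation by the subfield already supplies `p^n` roots
(`exists_eq_X_pow_sub_X_sub_C`).

Conversely, `h(A) = 0` makes `A^(p^(n+e)) - A^(p^e)` scalar, so `X^(p^(n+e)) - X^(p^e)` kills `ad
A`. Its degree is `m`, and `m` elements generate `M_m(F)` over `F[X]`; comparing dimensions gives
the invariant factors (`nonempty_aeval'_equiv`). -/

/-! ### Matrices killed by an irreducible polynomial of full degree. -/

section Cyclic

variable {F : Type*} [Field F] {m : ℕ} {A : Matrix (Fin m) (Fin m) F} {h : F[X]}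

theorem commute_aeval_self (A : Matrix (Fin m) (Fin m) F) (r : F[X]) : Commute (aeval A r) A := by
  simpa using (Commute.all r X).map (aeval A)

theorem dvd_of_aeval_mulVec_eq_zero (hirr : Irreducible h) (hA : aeval A h = 0)
    {v : Fin m → F} (hv : v ≠ 0) {r : F[X]} (hr : (aeval A r).mulVec v = 0) : h ∣ r := by
  by_contra hnd
  obtain ⟨s, t, hst⟩ := (hirr.coprime_iff_not_dvd).2 hnd
  apply hv
  have : (aeval A (s * h + t * r)).mulVec v = 0 := by
    rw [map_add, map_mul, map_mul, hA, mul_zero, zero_add, ← Matrix.mulVec_mulVec, hr,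
      Matrix.mulVec_zero]
  rwa [hst, map_one, Matrix.one_mulVec] at this

theorem linearIndependent_pow_mulVec (hirr : Irreducible h) (hdeg : m ≤ h.natDegree)
    (hA : aeval A h = 0) {v : Fin m → F} (hv : v ≠ 0) :
    LinearIndependent F (fun i : Fin m => (A ^ (i : ℕ)).mulVec v) := by
  rw [Fintype.linearIndependent_iff]
  intro g hg i
  set r : F[X] := ∑ i : Fin m, C (g i) * X ^ (i : ℕ) with hrdef
  have hr : (aeval A r).mulVec v = 0 := by
    rw [← hg, hrdef, map_sum, Matrix.sum_mulVec]
    refine Finset.sum_congr rfl fun i _ => ?_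
    rw [map_mul, map_pow, aeval_X, aeval_C, ← Algebra.smul_def, Matrix.smul_mulVec]
  have hdvd := dvd_of_aeval_mulVec_eq_zero hirr hA hv hr
  have hr0 : r = 0 := by
    refine eq_zero_of_dvd_of_degree_lt hdvd ?_
    refine (degree_sum_fin_lt g).trans_le ?_
    rw [degree_eq_natDegree hirr.ne_zero]
    exact_mod_cast hdeg
  have := congrArg (fun p => coeff p (i : ℕ)) hr0
  simpa [hrdef, finsetSum_coeff, coeff_X_pow, Fin.val_inj] using this

theorem exists_aeval_mulVec_eq (hirr : Irreducible h) (hdeg : m ≤ h.natDegree)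
    (hA : aeval A h = 0) {v : Fin m → F} (hv : v ≠ 0) (x : Fin m → F) :
    ∃ r : F[X], (aeval A r).mulVec v = x := by
  have hspan := (linearIndependent_pow_mulVec hirr hdeg hA hv).span_eq_top_of_card_eq_finrank'
    (by simp)
  have hx : x ∈ Submodule.span F (Set.range fun i : Fin m => (A ^ (i : ℕ)).mulVec v) := by
    rw [hspan]; trivial
  obtain ⟨c, hc⟩ := (Submodule.mem_span_range_iff_exists_fun F).1 hx
  refine ⟨∑ i : Fin m, C (c i) * X ^ (i : ℕ), ?_⟩
  rw [← hc, map_sum, Matrix.sum_mulVec]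
  refine Finset.sum_congr rfl fun i _ => ?_
  rw [map_mul, map_pow, aeval_X, aeval_C, ← Algebra.smul_def, Matrix.smul_mulVec]

theorem exists_mulVec_eq_zero_of_not_isUnit {B : Matrix (Fin m) (Fin m) F} (hB : ¬ IsUnit B) :
    ∃ v, v ≠ 0 ∧ B.mulVec v = 0 := by
  refine Matrix.exists_mulVec_eq_zero_iff.2 ?_
  rwa [Matrix.isUnit_iff_isUnit_det, isUnit_iff_ne_zero, not_not] at hB

/-- A nonzero intertwiner from a matrix `A'` acting irreducibly is invertible. -/
theorem isUnit_of_mul_eq_mul (hirr : Irreducible h) (hdeg : m ≤ h.natDegree)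
    (hA : aeval A h = 0) {A' B : Matrix (Fin m) (Fin m) F} (hB : B ≠ 0) (hAB : A' * B = B * A) :
    IsUnit B := by
  by_contra hu
  obtain ⟨v, hv, hBv⟩ := exists_mulVec_eq_zero_of_not_isUnit hu
  apply hB
  -- If `B v = 0`, then `B r(A) v = r(A') B v = 0`, and the vectors `r(A) v` fill the space.
  have hr : ∀ r : F[X], aeval A' r * B = B * aeval A r := by
    intro r
    induction r using Polynomial.induction_on' with
    | add p q hp hq => rw [map_add, map_add, add_mul, mul_add, hp, hq]
    | monomial k c =>
      have hk : A' ^ k * B = B * A ^ k := (SemiconjBy.pow_right (show SemiconjBy B A A' from hAB.symm) k).symm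
      rw [aeval_monomial, aeval_monomial, mul_assoc, hk, ← mul_assoc, ← mul_assoc,
        Algebra.commutes]
  refine Matrix.ext_of_mulVec_single fun i => ?_
  obtain ⟨r, hr'⟩ := exists_aeval_mulVec_eq hirr hdeg hA hv (Pi.single i 1)
  rw [← hr', Matrix.mulVec_mulVec, ← hr r, ← Matrix.mulVec_mulVec, hBv, Matrix.mulVec_zero,
    Matrix.zero_mulVec]

theorem monic_eq_X_pow_add_sum (hmon : h.Monic) (hdeg : h.natDegree = m) :
    h = X ^ m + ∑ i : Fin m, C (h.coeff i) * X ^ (i : ℕ) := by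
  conv_lhs => rw [hmon.as_sum, hdeg]
  rw [Finset.sum_range]

/-- Any `v ≠ 0` is cyclic; `P` has the columns `v, A v, …, A^(m-1) v`. -/
theorem matSimilar_companionMat (hirr : Irreducible h) (hmon : h.Monic) (hdeg : h.natDegree = m)
    (hA : aeval A h = 0) : MatSimilar A (companionMat m h) := by
  have hm : 0 < m := hdeg ▸ hirr.natDegree_pos
  obtain ⟨v, hv⟩ : ∃ v : Fin m → F, v ≠ 0 := ⟨Pi.single ⟨0, hm⟩ 1, by simp⟩
  set P : Matrix (Fin m) (Fin m) F := (Matrix.of fun i : Fin m => (A ^ (i : ℕ)).mulVec v).transpose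
    with hP
  have hPu : IsUnit P := by
    rw [hP, Matrix.isUnit_transpose, ← Matrix.linearIndependent_rows_iff_isUnit]
    exact linearIndependent_pow_mulVec hirr hdeg.ge hA hv
  have hcol : ∀ j, P.mulVec (Pi.single j 1) = (A ^ (j : ℕ)).mulVec v := by
    intro j
    rw [Matrix.mulVec_single_one]
    rfl
  have hAP : A * P = P * companionMat m h := by
    refine Matrix.ext_of_mulVec_single fun j => ?_
    rw [← Matrix.mulVec_mulVec, hcol, Matrix.mulVec_mulVec, ← pow_succ', ← Matrix.mulVec_mulVec,
      Matrix.mulVec_single_one (companionMat m h), Matrix.mulVec_eq_sum (companionMat m h |>.col j) P]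
    by_cases hj : (j : ℕ) + 1 = m
    · have h1 : (aeval A h).mulVec v = 0 := by rw [hA, Matrix.zero_mulVec]
      rw [monic_eq_X_pow_add_sum hmon hdeg, map_add, map_sum, Matrix.add_mulVec, Matrix.sum_mulVec,
        map_pow, aeval_X] at h1
      rw [hj, eq_neg_of_add_eq_zero_left h1, ← Finset.sum_neg_distrib]
      refine Finset.sum_congr rfl fun i _ => ?_
      ext k
      simp [companionMat, hj, hP, ← Algebra.smul_def, Matrix.smul_mulVec]
      exact mul_comm _ _
    · have hlt : (j : ℕ) + 1 < m := by omega
      rw [Finset.sum_eq_single ⟨(j : ℕ) + 1, hlt⟩]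
      · ext k
        simp [companionMat, hj, hP]
      · intro b _ hb
        have : (b : ℕ) ≠ j + 1 := fun h' => hb (Fin.ext h')
        simp [companionMat, hj, this]
      · simp
  refine ⟨hPu.unit, ?_⟩
  rw [mul_assoc, IsUnit.unit_spec, hAP, ← mul_assoc, IsUnit.val_inv_mul, one_mul]

/-- The first basis vector is cyclic. It is killed by `h(M)`, which commutes with `M^i`, so every
basis vector is killed. -/
theorem aeval_companionMat (hmon : h.Monic) (hdeg : h.natDegree = m) :
    aeval (companionMat m h) h = 0 := by
  set M := companionMat m h with hM
  rcases Nat.eq_zero_or_pos m with rfl | hm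
  · exact Subsingleton.elim _ _
  set v : Fin m → F := Pi.single ⟨0, hm⟩ 1
  have hpow : ∀ i (hi : i < m), (M ^ i).mulVec v = Pi.single ⟨i, hi⟩ 1 := by
    intro i
    induction i with
    | zero => intro hi; rw [pow_zero, Matrix.one_mulVec]
    | succ i ih =>
      intro hi
      rw [pow_succ', ← Matrix.mulVec_mulVec, ih (by omega), Matrix.mulVec_single_one]
      ext k
      simp only [hM, companionMat, Matrix.col_apply, Matrix.of_apply, Pi.single_apply, Fin.ext_iff]
      rw [if_neg (by omega)]
  have htop : (M ^ m).mulVec v = fun i : Fin m => - h.coeff i := by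
    obtain ⟨k, rfl⟩ : ∃ k, m = k + 1 := ⟨m - 1, by omega⟩
    rw [pow_succ', ← Matrix.mulVec_mulVec, hpow k (by omega), Matrix.mulVec_single_one]
    ext i
    simp [hM, companionMat]
  have hv : (aeval M h).mulVec v = 0 := by
    conv_lhs => rw [monic_eq_X_pow_add_sum hmon hdeg]
    rw [map_add, map_sum, Matrix.add_mulVec, Matrix.sum_mulVec, map_pow, aeval_X, htop]
    ext k
    simp only [map_mul, map_pow, aeval_X, aeval_C, ← Algebra.smul_def, Matrix.smul_mulVec,
      hpow _ (Fin.is_lt _), Pi.add_apply, Finset.sum_apply, Pi.smul_apply, Pi.single_apply,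
      Pi.zero_apply, Fin.ext_iff]
    simp [← Fin.ext_iff]
  refine Matrix.ext_of_mulVec_single fun i => ?_
  rw [← hpow i i.2, Matrix.mulVec_mulVec, ((commute_aeval_self M h).pow_right i).eq, ← Matrix.mulVec_mulVec, hv, Matrix.mulVec_zero,
    Matrix.zero_mulVec]

theorem aeval_conj {A B : Matrix (Fin m) (Fin m) F} {P : (Matrix (Fin m) (Fin m) F)ˣ}
    (hB : B = (P⁻¹).val * A * P.val) (r : F[X]) :
    aeval B r = (P⁻¹).val * aeval A r * P.val := by
  induction r using Polynomial.induction_on' with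
  | add p q hp hq => rw [map_add, map_add, hp, hq, mul_add, add_mul]
  | monomial k c =>
    rw [aeval_monomial, aeval_monomial, hB, Units.conj_pow', ← mul_assoc, ← mul_assoc, ← mul_assoc,
      Algebra.commutes]

theorem aeval_eq_zero_of_matSimilar (hmon : h.Monic) (hdeg : h.natDegree = m)
    (hs : MatSimilar A (companionMat m h)) : aeval A h = 0 := by
  obtain ⟨P, hP⟩ := hs
  have h1 := aeval_conj hP h
  rw [aeval_companionMat hmon hdeg] at h1
  have h2 := congrArg (fun M => P.val * M * (P⁻¹).val) h1
  simpa [mul_assoc] using h2.symm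

/-- Two matrices killed by the same irreducible polynomial of degree `m` are intertwined. -/
theorem exists_isUnit_mul_eq_mul (hirr : Irreducible h) (hmon : h.Monic) (hdeg : h.natDegree = m)
    (hA : aeval A h = 0) {A' : Matrix (Fin m) (Fin m) F} (hA' : aeval A' h = 0) :
    ∃ B, IsUnit B ∧ A' * B = B * A := by
  obtain ⟨P, hP⟩ := matSimilar_companionMat hirr hmon hdeg hA
  obtain ⟨Q, hQ⟩ := matSimilar_companionMat hirr hmon hdeg hA'
  refine ⟨Q.val * (P⁻¹).val, (Q * P⁻¹).isUnit, ?_⟩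
  have : (P⁻¹).val * A = (Q⁻¹).val * A' * Q.val * (P⁻¹).val := by
    rw [← hQ, hP]; simp [mul_assoc]
  rw [mul_assoc, this]
  simp [mul_assoc]

/-- A matrix commuting with `A` agrees at `v` with some `r(A)`; the difference is a self-intertwiner
that is not invertible, hence zero. So the centralizer is `F[A]`. -/
theorem isField_centralizer (hirr : Irreducible h) (hdeg : h.natDegree = m)
    (hA : aeval A h = 0) :
    IsField (Subalgebra.centralizer F ({A} : Set (Matrix (Fin m) (Fin m) F))) := by
  have hm : 0 < m := hdeg ▸ hirr.natDegree_pos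
  have : Nonempty (Fin m) := ⟨⟨0, hm⟩⟩
  obtain ⟨v, hv⟩ : ∃ v : Fin m → F, v ≠ 0 := ⟨Pi.single ⟨0, hm⟩ 1, by simp⟩
  have hpoly : ∀ B : Matrix (Fin m) (Fin m) F, A * B = B * A → ∃ r : F[X], B = aeval A r := by
    intro B hB
    obtain ⟨r, hr⟩ := exists_aeval_mulVec_eq hirr hdeg.ge hA hv (B.mulVec v)
    refine ⟨r, ?_⟩
    by_contra hne
    have hu := isUnit_of_mul_eq_mul hirr hdeg.ge hA (A' := A) (sub_ne_zero.2 hne) (by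
      rw [mul_sub, sub_mul, hB, (commute_aeval_self A r).eq])
    refine hv (Matrix.mulVec_injective_of_isUnit hu ?_)
    rw [Matrix.sub_mulVec, hr, sub_self, Matrix.mulVec_zero]
  refine ⟨⟨0, 1, zero_ne_one⟩, ?_, ?_⟩
  · rintro ⟨B, hB⟩ ⟨B', hB'⟩
    rw [Subalgebra.mem_centralizer_iff] at hB hB'
    obtain ⟨r, rfl⟩ := hpoly B (hB A rfl)
    obtain ⟨s, rfl⟩ := hpoly B' (hB' A rfl)
    refine Subtype.ext ?_
    simp only [MulMemClass.mk_mul_mk]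
    rw [← map_mul, mul_comm, map_mul]
  · rintro ⟨B, hB⟩ hne
    have hB' := hB
    rw [Subalgebra.mem_centralizer_iff] at hB
    have hu := isUnit_of_mul_eq_mul hirr hdeg.ge hA (fun h0 => hne (Subtype.ext h0)) (hB A rfl)
    obtain ⟨u, rfl⟩ := hu
    refine ⟨⟨(u⁻¹).val, ?_⟩, Subtype.ext (by simp)⟩
    rw [Subalgebra.mem_centralizer_iff]
    rintro _ rfl
    exact (Commute.units_inv_right (show Commute _ _ from hB _ rfl)).eq

/-- If the centralizer of `A` is a field, then the minimal polynomial of `A` is irreducible of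
degree `m`. -/
theorem irreducible_minpoly_of_isField_centralizer
    (hZ : IsField (Subalgebra.centralizer F ({A} : Set (Matrix (Fin m) (Fin m) F)))) :
    Irreducible (minpoly F A) ∧ (minpoly F A).natDegree = m := by
  set Z := Subalgebra.centralizer F ({A} : Set (Matrix (Fin m) (Fin m) F))
  have : IsDomain Z := hZ.isDomain
  have hA : A ∈ Z := by
    rw [Subalgebra.mem_centralizer_iff]
    rintro _ rfl
    rfl
  have hirr : Irreducible (minpoly F A) := by
    have h1 := minpoly.algHom_eq Z.val Subtype.val_injective ⟨A, hA⟩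
    rw [Subalgebra.val_apply] at h1
    rw [h1]
    exact minpoly.irreducible (Algebra.IsIntegral.isIntegral _)
  have hmon : (minpoly F A).Monic := minpoly.monic (Algebra.IsIntegral.isIntegral _)
  refine ⟨hirr, le_antisymm ?_ ?_⟩
  · have h1 := natDegree_le_of_dvd (Matrix.minpoly_dvd_charpoly A) (Matrix.charpoly_monic A).ne_zero
    rwa [Matrix.charpoly_natDegree_eq_dim, Fintype.card_fin] at h1
  rcases Nat.eq_zero_or_pos m with rfl | hm
  · exact Nat.zero_le _
  obtain ⟨v, hv⟩ : ∃ v : Fin m → F, v ≠ 0 := ⟨Pi.single ⟨0, hm⟩ 1, by simp⟩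
  set T : F[X] →ₗ[F] (Fin m → F) :=
    ((Matrix.mulVecBilin F F).flip v) ∘ₗ (aeval A).toLinearMap
  have hT : ∀ r, T r = (aeval A r).mulVec v := fun r => rfl
  set W : Submodule F (Fin m → F) := (degreeLT F (minpoly F A).natDegree).map T
  have hTW : ∀ r, T r ∈ W := by
    intro r
    refine ⟨r %ₘ minpoly F A, ?_, ?_⟩
    · rw [SetLike.mem_coe, mem_degreeLT, ← degree_eq_natDegree hmon.ne_zero]
      exact degree_modByMonic_lt _ hmon
    · rw [hT, hT, aeval_modByMonic_eq_self_of_root (minpoly.aeval F A)]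
  have hWinv : W ∈ Module.End.invtSubmodule (Matrix.toLin' A) := by
    rw [Module.End.mem_invtSubmodule]
    rintro _ ⟨r, -, rfl⟩
    have : Matrix.toLin' A (T r) = T (X * r) := by
      rw [hT, hT, Matrix.toLin'_apply, map_mul, aeval_X, Matrix.mulVec_mulVec]
    rw [Submodule.mem_comap, this]
    exact hTW _
  -- `W` is the cyclic subspace `F[A] v`. By semisimplicity it has an `A`-stable complement, so the
  -- projection onto `W` is an idempotent of the field `Z`. It fixes `v ≠ 0`, so it is the identity.
  have hWtop : W = ⊤ := by
    have hss : Module.End.IsSemisimple (Matrix.toLin' A) := by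
      refine Module.End.isSemisimple_of_squarefree_aeval_eq_zero hirr.squarefree ?_
      have h1 := aeval_algHom_apply (Matrix.toLinAlgEquiv' (R := F) (n := Fin m)).toAlgHom A
        (minpoly F A)
      rw [minpoly.aeval, map_zero] at h1
      exact h1
    obtain ⟨W', hW', hc⟩ := Module.End.isSemisimple_iff.1 hss W hWinv
    have hidem := Submodule.isIdempotentElem_projection hc
    have hcomm : Commute (W.projection W' hc) (Matrix.toLin' A) := by
      rw [LinearMap.IsIdempotentElem.commute_iff hidem, Submodule.range_projection,
        Submodule.ker_projection]
      exact ⟨hWinv, hW'⟩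
    set P := LinearMap.toMatrix' (W.projection W' hc) with hP
    have hPA : P ∈ Z := by
      rw [Subalgebra.mem_centralizer_iff]
      rintro _ rfl
      have := congrArg LinearMap.toMatrix' hcomm.eq.symm
      rwa [LinearMap.toMatrix'_mul, LinearMap.toMatrix'_mul, LinearMap.toMatrix'_toLin'] at this
    have hPP : P * P = P := by rw [hP, ← LinearMap.toMatrix'_mul, hidem.eq]
    have h01 : (⟨P, hPA⟩ : Z) = 0 ∨ (⟨P, hPA⟩ : Z) = 1 :=
      IsIdempotentElem.iff_eq_zero_or_one.1 (Subtype.ext hPP)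
    have hPv : P.mulVec v = v := by
      rw [hP, ← Matrix.toLin'_apply, Matrix.toLin'_toMatrix']
      refine Submodule.projection_apply_of_mem_left _ ?_
      simpa [hT] using hTW 1
    rcases h01 with h0 | h1
    · have : P = 0 := congrArg Subtype.val h0
      rw [this, Matrix.zero_mulVec] at hPv
      exact (hv hPv.symm).elim
    · have : P = 1 := congrArg Subtype.val h1
      have h2 : W.projection W' hc = 1 := LinearMap.toMatrix'.injective (by
        rw [← hP, this, LinearMap.toMatrix'_one])
      rw [← Submodule.range_projection hc, h2]
      exact LinearMap.range_id
  have h1 : Module.finrank F W ≤ _ := Submodule.finrank_map_le T _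
  rwa [hWtop, finrank_top, Module.finrank_fin_fun, (degreeLTEquiv F _).finrank_eq,
    Module.finrank_fin_fun] at h1

end Cyclic

/-! ### Eigenvalues of `ad A` as translations, and the forward implication. -/

section Ad

variable {F : Type*} [Field F] {m : ℕ} {A : Matrix (Fin m) (Fin m) F} {h : F[X]}

theorem adMat_apply (A B : Matrix (Fin m) (Fin m) F) : adMat A B = A * B - B * A := rfl

theorem adMat_apply_eq_smul_iff (A B : Matrix (Fin m) (Fin m) F) (c : F) :
    adMat A B = c • B ↔ A * B = B * (A + algebraMap F _ c) := by
  rw [adMat_apply, mul_add, ← Algebra.commutes, ← Algebra.smul_def, sub_eq_iff_eq_add, add_comm]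

theorem aeval_add_algebraMap {R : Type*} [Ring R] [Algebra F R] (A : R) (c : F) (r : F[X]) :
    aeval (A + algebraMap F R c) r = aeval A (r.comp (X + C c)) := by
  rw [aeval_comp, map_add, aeval_X, aeval_C]

/-- An eigenvector conjugates `A` to `A + c`, so `h(X + c)` kills `A` and is divisible by `h`; both
are monic of the same degree. -/
theorem comp_X_add_C_eq_self (hirr : Irreducible h) (hmon : h.Monic) (hdeg : h.natDegree = m)
    (hA : aeval A h = 0) {c : F} (hc : (adMat A).HasEigenvalue c) : h.comp (X + C c) = h := by
  obtain ⟨B, hB⟩ := hc.exists_hasEigenvector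
  have hAB := (adMat_apply_eq_smul_iff A B c).1 hB.apply_eq_smul
  have hm : 0 < m := hdeg ▸ hirr.natDegree_pos
  obtain ⟨v, hv⟩ : ∃ v : Fin m → F, v ≠ 0 := ⟨Pi.single ⟨0, hm⟩ 1, by simp⟩
  have hBA : (A - algebraMap F _ c) * B = B * A := by
    rw [sub_mul, hAB, mul_add, Algebra.commutes, add_sub_cancel_right]
  obtain ⟨u, rfl⟩ := isUnit_of_mul_eq_mul hirr hdeg.ge hA hB.2 hBA
  have h1 := aeval_conj (A := A) (B := A + algebraMap F _ c) (P := u)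
    (by rw [mul_assoc, hAB, ← mul_assoc, Units.inv_mul, one_mul]) h
  rw [hA, mul_zero, zero_mul, aeval_add_algebraMap] at h1
  have hdvd := dvd_of_aeval_mulVec_eq_zero hirr hA hv (r := h.comp (X + C c))
    (by rw [h1, Matrix.zero_mulVec])
  refine (eq_of_monic_of_dvd_of_natDegree_le hmon (hmon.comp_X_add_C c) hdvd ?_)
  rw [natDegree_comp, natDegree_X_add_C, mul_one]

theorem commute_mulLeft_mulRight (A : Matrix (Fin m) (Fin m) F) :
    Commute (LinearMap.mulLeft F A) (LinearMap.mulRight F A) :=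
  LinearMap.commute_mulLeft_right A A

theorem adMat_pow_apply {p : ℕ} [Fact p.Prime] [CharP F p] (A B : Matrix (Fin m) (Fin m) F)
    (i : ℕ) : (adMat A ^ p ^ i) B = A ^ p ^ i * B - B * A ^ p ^ i := by
  rcases Nat.eq_zero_or_pos m with rfl | hm
  · exact Subsingleton.elim _ _
  have : Nonempty (Fin m) := ⟨⟨0, hm⟩⟩
  have : CharP (Module.End F (Matrix (Fin m) (Fin m) F)) p :=
    charP_of_injective_algebraMap (FaithfulSMul.algebraMap_injective F _) p
  rw [adMat, sub_pow_char_pow_of_commute p _ (commute_mulLeft_mulRight A), LinearMap.pow_mulLeft,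
    LinearMap.pow_mulRight]
  rfl

/-- Over the closure every linear factor of the characteristic polynomial divides `G`, so their
product divides a power of `G`; Cayley–Hamilton concludes. -/
theorem aeval_pow_natDegree_eq_zero_of_allEigenvaluesIn {V : Type*} [AddCommGroup V] [Module F V]
    [FiniteDimensional F V] {f : Module.End F V} (hf : AllEigenvaluesIn f) {G : F[X]}
    (hG : ∀ b, f.HasEigenvalue b → G.eval b = 0) : aeval f (G ^ f.charpoly.natDegree) = 0 := by
  have key : f.charpoly ∣ G ^ f.charpoly.natDegree := by
    rw [← map_dvd_map' (algebraMap F (AlgebraicClosure F))]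
    set L := AlgebraicClosure F
    set P := f.charpoly.map (algebraMap F L) with hP
    have hs : P.Splits := IsAlgClosed.splits P
    have hmon : P.Monic := f.charpoly_monic.map _
    have hroot : ∀ μ ∈ P.roots, X - C μ ∣ G.map (algebraMap F L) := by
      intro μ hμ
      have hμ' : P.IsRoot μ := isRoot_of_mem_roots hμ
      have : Module.End.HasEigenvalue (LinearMap.baseChange L f) μ := by
        rw [Module.End.hasEigenvalue_iff_isRoot_charpoly, LinearMap.charpoly_baseChange]
        exact hμ'
      obtain ⟨b, rfl⟩ := hf μ this
      rw [hP, IsRoot.def, eval_map_algebraMap, aeval_algebraMap_apply, map_eq_zero] at hμ'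
      have hb := hG b ((Module.End.hasEigenvalue_iff_isRoot_charpoly f b).2 hμ')
      rw [dvd_iff_isRoot, IsRoot.def, eval_map_algebraMap, aeval_algebraMap_apply,
        coe_aeval_eq_eval, hb, map_zero]
    have h1 := Multiset.prod_dvd_prod_of_dvd (S := P.roots) _ _ hroot
    rw [Multiset.map_const', Multiset.prod_replicate, ← hs.natDegree_eq_card_roots,
      natDegree_map] at h1
    rwa [Polynomial.map_pow, hs.eq_prod_roots_of_monic hmon]
  obtain ⟨r, hr⟩ := key
  rw [hr, map_mul, LinearMap.aeval_self_charpoly, zero_mul]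

theorem Subfield.pow_natCard_eq {p n : ℕ} {K : Subfield F} (hp : p.Prime)
    (hK : Nat.card K = p ^ n) {c : F} (hc : c ∈ K) : c ^ p ^ n = c := by
  have : Finite K := Nat.finite_of_card_ne_zero (by rw [hK]; exact pow_ne_zero _ hp.ne_zero)
  have := Fintype.ofFinite K
  have h1 := FiniteField.pow_card (⟨c, hc⟩ : K)
  rw [← Nat.card_eq_fintype_card, hK] at h1
  exact congrArg Subtype.val h1

/-- If `(X ^ p ^ n - X) ^ p ^ k` annihilates `ad A`, then it takes a scalar value at `A`. -/
theorem exists_minpoly_dvd_of_aeval_adMat_eq_zero {p n k : ℕ} [Fact p.Prime] [CharP F p]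
    (had : aeval (adMat A) ((X ^ p ^ n - X : F[X]) ^ p ^ k) = 0) :
    ∃ b, minpoly F A ∣ X ^ p ^ (n + k) - X ^ p ^ k - C b := by
  have hexp : ((X ^ p ^ n - X : F[X]) ^ p ^ k) = X ^ p ^ (n + k) - X ^ p ^ k := by
    rw [sub_pow_char_pow, ← pow_mul, pow_add]
  -- The annihilating polynomial is additive, so its value at `ad A` is `ad` of its value at `A`.
  have hcomm : ∀ B : Matrix (Fin m) (Fin m) F,
      (A ^ p ^ (n + k) - A ^ p ^ k) * B = B * (A ^ p ^ (n + k) - A ^ p ^ k) := by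
    intro B
    have h1 := congrArg (fun T => T B) had
    rw [hexp] at h1
    simp only [map_sub, map_pow, aeval_X, LinearMap.sub_apply, adMat_pow_apply,
      LinearMap.zero_apply] at h1
    rw [sub_mul, mul_sub, ← sub_eq_zero, ← h1]
    abel
  obtain ⟨b, hb⟩ := Matrix.mem_range_scalar_of_commute_single
    (M := A ^ p ^ (n + k) - A ^ p ^ k) (fun i j _ => (hcomm _).symm)
  refine ⟨b, minpoly.dvd F A ?_⟩
  rw [map_sub, map_sub, map_pow, map_pow, aeval_X, aeval_C, ← hb, sub_eq_zero]
  rfl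

theorem Subfield.exists_prime_card {K : Subfield F} (hK : Finite K) :
    ∃ p n : ℕ, p.Prime ∧ CharP F p ∧ 1 ≤ n ∧ Nat.card K = p ^ n := by
  have := Fintype.ofFinite K
  obtain ⟨p, hp⟩ := CharP.exists K
  obtain ⟨n, hpp, hn⟩ := FiniteField.card K p
  exact ⟨p, n, hpp, charP_of_injective_ringHom K.subtype.injective p, n.2,
    by rw [Nat.card_eq_fintype_card, hn]⟩

/-- An irreducible polynomial invariant under translation by a finite field `K` and dividing a
polynomial `(X ^ p ^ n - X) ^ p ^ k - b` has separable part `X ^ p ^ n - X - a`. -/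
theorem exists_eq_X_pow_sub_X_sub_C {p n k e : ℕ} [Fact p.Prime] [CharP F p] (hn : 1 ≤ n)
    {K : Subfield F} (hK : Nat.card K = p ^ n) {q : F[X]} (hirr : Irreducible h) (hmon : h.Monic)
    (hq : q.Separable) (hqh : expand F (p ^ e) q = h)
    (htrans : ∀ c ∈ K, h.comp (X + C c) = h) {b : F}
    (hdvd : h ∣ X ^ p ^ (n + k) - X ^ p ^ k - C b) :
    ∃ a, q = X ^ p ^ n - X - C a := by
  have hp : p.Prime := Fact.out
  classical
  set L := AlgebraicClosure F
  have : CharP L p := charP_of_injective_algebraMap (algebraMap F L).injective p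
  have hroot : ∀ x : L, aeval x h = aeval (x ^ p ^ e) q := by
    intro x; rw [← hqh, expand_aeval]
  obtain ⟨α, hα⟩ := IsAlgClosed.exists_aeval_eq_zero L h (degree_pos_of_irreducible hirr).ne'
  set β := α ^ p ^ e
  have hfrob : ∀ i, Function.Injective fun x : L => x ^ p ^ i := by
    intro i x y hxy
    exact iterateFrobenius_inj L p i (by simpa [iterateFrobenius_def] using hxy)
  -- By injectivity of Frobenius, `x^(p^n) - x` is therefore the same for all roots `x` of `h`.
  have hg : ∀ x : L, aeval x h = 0 → (x ^ p ^ n - x) ^ p ^ k = algebraMap F L b := by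
    intro x hx
    obtain ⟨r, hr⟩ := hdvd
    have h1 := congrArg (aeval x) hr
    rw [map_mul, hx, zero_mul, map_sub, map_sub, map_pow, map_pow, aeval_X, aeval_C,
      sub_eq_zero] at h1
    rw [sub_pow_char_pow, ← pow_mul, ← pow_add, h1]
  set P : L[X] := X ^ p ^ n - X - C (β ^ p ^ n - β) with hP
  have hpn : 1 < p ^ n := Nat.one_lt_pow (by omega) hp.one_lt
  have hPdeg : P.natDegree = p ^ n := by
    rw [hP, natDegree_sub_C, FiniteField.X_pow_card_sub_X_natDegree_eq _ hpn]
  have hPmon : P.Monic := by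
    rw [hP, sub_sub]
    exact monic_X_pow_sub (by rw [degree_X_add_C]; exact_mod_cast hpn)
  have hqmon : q.Monic := by
    rwa [← hqh, monic_expand_iff (pow_pos hp.pos e)] at hmon
  have hqs : (q.map (algebraMap F L)).Splits := IsAlgClosed.splits _
  have hqLmon : (q.map (algebraMap F L)).Monic := hqmon.map _
  -- As `q` has simple roots, it suffices that each is a root of `P`; each is `δ^(p^e)` with `δ` a
  -- root of `h`.
  have hqP : q.map (algebraMap F L) ∣ P := by
    rw [hqs.eq_prod_roots_of_monic hqLmon, Multiset.prod_X_sub_C_dvd_iff_le_roots hPmon.ne_zero,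
      Multiset.le_iff_subset (nodup_roots hq.map)]
    intro γ hγ
    have hγ' : aeval γ q = 0 := by
      have := isRoot_of_mem_roots hγ
      rwa [IsRoot.def, eval_map_algebraMap] at this
    obtain ⟨δ, rfl⟩ := IsAlgClosed.exists_pow_nat_eq γ (pow_pos hp.pos e)
    rw [← hroot] at hγ'
    have h1 : δ ^ p ^ n - δ = α ^ p ^ n - α := hfrob k ((hg δ hγ').trans (hg α hα).symm)
    rw [mem_roots hPmon.ne_zero, IsRoot.def, hP]
    simp only [eval_sub, eval_pow, eval_X, eval_C, β]
    rw [pow_right_comm, pow_right_comm α, ← sub_pow_char_pow, h1, ← sub_pow_char_pow, sub_self]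
  -- Translation invariance makes `(α + c)^(p^e)`, for `c ∈ K`, distinct roots of `q`.
  have hdegq : p ^ n ≤ (q.map (algebraMap F L)).natDegree := by
    have : Finite K := Nat.finite_of_card_ne_zero (by rw [hK]; omega)
    have := Fintype.ofFinite K
    rw [← hK, Nat.card_eq_fintype_card, ← Finset.card_univ]
    refine (Finset.card_le_card_of_injOn (t := (q.map (algebraMap F L)).roots.toFinset)
      (fun c : K => (α + algebraMap F L c) ^ p ^ e) ?_ ?_).trans
      ((Multiset.toFinset_card_le _).trans (card_roots' _))
    · intro c _
      rw [Finset.mem_coe, Multiset.mem_toFinset, mem_roots hqLmon.ne_zero, IsRoot.def,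
        eval_map_algebraMap, ← hroot, aeval_add_algebraMap, htrans c c.2, hα]
    · intro c _ d _ hcd
      have := add_left_cancel (hfrob e hcd)
      exact Subtype.ext ((algebraMap F L).injective this)
  have hqP' : P = q.map (algebraMap F L) :=
    eq_of_monic_of_dvd_of_natDegree_le hqLmon hPmon hqP (hPdeg.trans_le hdegq)
  -- The constant of `P` lies in `F`, being up to sign a coefficient of `q`.
  refine ⟨-q.coeff 0, map_injective _ (algebraMap F L).injective ?_⟩
  have h0 := congrArg (fun r => r.coeff 0) hqP'
  simp only [hP, coeff_sub, coeff_X_pow, coeff_X_zero, coeff_C_zero, coeff_map] at h0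
  rw [if_neg (by omega), sub_zero, zero_sub] at h0
  rw [← hqP', hP]
  simp only [Polynomial.map_sub, Polynomial.map_pow, map_X, Polynomial.map_C, Polynomial.map_neg, map_neg, ← h0, neg_neg]

theorem exists_isGenArtinSchreier (h1 : AllEigenvaluesIn (adMat A))
    (h2 : ∃ S : Subfield F, (S : Set F) = eigenvalueSet (adMat A))
    (h3 : IsField (Subalgebra.centralizer F ({A} : Set (Matrix (Fin m) (Fin m) F)))) :
    ∃ (p : ℕ) (h q : F[X]) (e n : ℕ) (a : F) (K : Subfield F),
      IsGenArtinSchreier A p h q e n a K := by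
  obtain ⟨K, hK⟩ := h2
  have hmem : ∀ c, c ∈ K ↔ (adMat A).HasEigenvalue c := fun c => Set.ext_iff.1 hK c
  have hfin : Finite K := by
    have : (K : Set F).Finite := by rw [hK]; exact (adMat A).finite_hasEigenvalue
    exact this
  obtain ⟨p, n, hp, hchar, hn, hcard⟩ := Subfield.exists_prime_card hfin
  have : Fact p.Prime := ⟨hp⟩
  obtain ⟨hirr, hdeg⟩ := irreducible_minpoly_of_isField_centralizer h3
  have hmon : (minpoly F A).Monic := minpoly.monic (Algebra.IsIntegral.isIntegral _)
  obtain ⟨e, q, hq, hqh⟩ := exists_separable_of_irreducible p hirr hp.ne_zero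
  set N := (adMat A).charpoly.natDegree
  have hann : aeval (adMat A) ((X ^ p ^ n - X : F[X]) ^ p ^ N) = 0 := by
    have h4 := aeval_pow_natDegree_eq_zero_of_allEigenvaluesIn h1 (G := X ^ p ^ n - X) (by
      intro b hb
      simp [Subfield.pow_natCard_eq hp hcard ((hmem b).2 hb)])
    -- The exponent `N` is raised to `p^N ≥ N` so that the power is an iterated Frobenius.
    obtain ⟨j, hj⟩ := Nat.exists_eq_add_of_le (Nat.lt_pow_self hp.one_lt (n := N)).le
    rw [hj, pow_add, map_mul, h4, zero_mul]
  obtain ⟨b, hb⟩ := exists_minpoly_dvd_of_aeval_adMat_eq_zero hann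
  obtain ⟨a, ha⟩ := exists_eq_X_pow_sub_X_sub_C hn hcard hirr hmon hq hqh
    (fun c hc => comp_X_add_C_eq_self hirr hmon hdeg (minpoly.aeval F A) ((hmem c).1 hc)) hb
  exact ⟨p, minpoly F A, q, e, n, a, K, hp, hchar, hmon, hirr, hdeg,
    matSimilar_companionMat hirr hmon hdeg (minpoly.aeval F A), ⟨hq, hqh.symm⟩, hn, ha, hcard⟩

end Ad

/-! ### Eigenvalue identities and products of distinct linear factors. -/

section Eigen

variable {F V : Type*} [Field F] [AddCommGroup V] [Module F V]

theorem pow_eq_pow_of_hasEigenvalue {f : Module.End F V} {a b : ℕ} (hf : f ^ a = f ^ b) {μ : F}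
    (hμ : f.HasEigenvalue μ) : μ ^ a = μ ^ b := by
  obtain ⟨x, hx⟩ := hμ.exists_hasEigenvector
  refine smul_left_injective F hx.2 ?_
  change μ ^ a • x = μ ^ b • x
  rw [← hx.pow_apply, ← hx.pow_apply, hf]

theorem ker_aeval_prod_le_span (f : Module.End F V) (s : Finset F) :
    LinearMap.ker (aeval f (∏ c ∈ s, (X - C c))) ≤
      Submodule.span F {v | ∃ c : F, f v = c • v} := by
  classical
  induction s using Finset.induction_on with
  | empty => simp [Module.End.one_eq_id]
  | insert a s ha ih =>
    rw [Finset.prod_insert ha, ← sup_ker_aeval_eq_ker_aeval_mul_of_coprime]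
    · refine sup_le (fun v hv => Submodule.subset_span ⟨a, ?_⟩) ih
      simpa [sub_eq_zero] using hv
    · refine IsCoprime.prod_right fun c hc => ?_
      have hac : a ≠ c := by rintro rfl; exact ha hc
      exact isCoprime_X_sub_C_of_isUnit_sub (sub_ne_zero.2 hac).isUnit

theorem isDiagonalizableEnd_of_span_eq_top {f : Module.End F V}
    (hf : Submodule.span F {v | ∃ c : F, f v = c • v} = ⊤) : IsDiagonalizableEnd f :=
  ⟨_, Module.Basis.ofSpan hf.ge, fun i => Module.Basis.ofSpan_subset hf.ge ⟨i, rfl⟩⟩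

theorem Subfield.prod_X_sub_C_eq {p n : ℕ} {K : Subfield F} (hp : p.Prime)
    (hK : Nat.card K = p ^ n) : ∃ s : Finset F, (∀ c, c ∈ s ↔ c ∈ K) ∧
      ∏ c ∈ s, (X - C c) = (X ^ p ^ n - X : F[X]) := by
  classical
  have : Finite K := Nat.finite_of_card_ne_zero (by rw [hK]; exact pow_ne_zero _ hp.ne_zero)
  have := Fintype.ofFinite K
  rw [Nat.card_eq_fintype_card] at hK
  have h1 : ∏ c : K, (X - C c) = (X ^ p ^ n - X : K[X]) := by
    rw [← hK]
    have hc : 1 < Fintype.card K := Fintype.one_lt_card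
    have hmon : (X ^ Fintype.card K - X : K[X]).Monic :=
      monic_X_pow_sub (by rw [degree_X]; exact_mod_cast hc)
    have h2 := prod_multiset_X_sub_C_of_monic_of_roots_card_eq hmon (by
      rw [FiniteField.roots_X_pow_card_sub_X, FiniteField.X_pow_card_sub_X_natDegree_eq _ hc]
      rfl)
    rwa [FiniteField.roots_X_pow_card_sub_X] at h2
  refine ⟨Finset.univ.image (fun c : K => (c : F)), by simp, ?_⟩
  rw [Finset.prod_image (fun x _ y _ h => Subtype.ext h)]
  have h2 := congrArg (Polynomial.map K.subtype) h1
  simpa [Polynomial.map_prod] using h2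

end Eigen

/-! ### `M_m(F)` as an `F[X]`-module under `ad A`. -/

section Bimodule

variable {F : Type*} [Field F] {m : ℕ} {A : Matrix (Fin m) (Fin m) F} {h : F[X]}

theorem transpose_aeval (A : Matrix (Fin m) (Fin m) F) (r : F[X]) :
    (aeval A r).transpose = aeval A.transpose r := by
  induction r using Polynomial.induction_on' with
  | add p q hp hq => rw [map_add, map_add, Matrix.transpose_add, hp, hq]
  | monomial k c =>
    rw [aeval_monomial, aeval_monomial, ← Algebra.smul_def, ← Algebra.smul_def,
      Matrix.transpose_smul, Matrix.transpose_pow]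

/-- With `B = v vᵀ`, the products `r(A) B s(A)` yield all rank-one matrices, since `v` is cyclic for
both `A` and its transpose. The span is stable under right multiplication by `A` because that is
left multiplication minus `ad A`. -/
theorem exists_span_pow_mul_eq_top (hirr : Irreducible h) (hmon : h.Monic) (hdeg : h.natDegree = m)
    (hA : aeval A h = 0) : ∃ B : Matrix (Fin m) (Fin m) F,
      Submodule.span F[X] (Set.range fun i : Fin m =>
        Module.AEval'.of (adMat A) (A ^ (i : ℕ) * B)) = ⊤ := by
  have hm : 0 < m := hdeg ▸ hirr.natDegree_pos
  obtain ⟨v, hv⟩ : ∃ v : Fin m → F, v ≠ 0 := ⟨Pi.single ⟨0, hm⟩ 1, by simp⟩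
  have hAt : aeval A.transpose h = 0 := by rw [← transpose_aeval, hA, Matrix.transpose_zero]
  set B := Matrix.vecMulVec v v with hB
  refine ⟨B, ?_⟩
  set N := Submodule.span F[X] (Set.range fun i : Fin m =>
        Module.AEval'.of (adMat A) (A ^ (i : ℕ) * B)) with hN
  have hsmul : ∀ (c : F) (M), Module.AEval'.of (adMat A) M ∈ N →
      Module.AEval'.of (adMat A) (c • M) ∈ N := by
    intro c M hM
    rw [map_smul, ← Module.AEval.C_smul]
    exact N.smul_mem _ hM
  -- Quantifying over `r` builds stability under left multiplication by `F[A]` into the predicate.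
  set Q : Matrix (Fin m) (Fin m) F → Prop :=
    fun M => ∀ r : F[X], Module.AEval'.of (adMat A) (aeval A r * M) ∈ N with hQ
  have hQB : Q B := by
    intro r
    have h1 : aeval A r = ∑ i : Fin m, (r %ₘ h).coeff i • A ^ (i : ℕ) := by
      rw [← aeval_modByMonic_eq_self_of_root hA]
      have h2 : (r %ₘ h).natDegree < m := hdeg ▸ natDegree_modByMonic_lt _ hmon hirr.ne_one
      rw [aeval_eq_sum_range' h2, Finset.sum_range]
    rw [h1, Finset.sum_mul, map_sum]
    refine N.sum_mem fun i _ => ?_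
    rw [smul_mul_assoc]
    exact hsmul _ _ (Submodule.subset_span ⟨i, rfl⟩)
  have hQadd : ∀ M M', Q M → Q M' → Q (M + M') := by
    intro M M' hM hM' r
    rw [mul_add, map_add]
    exact N.add_mem (hM r) (hM' r)
  have hQsmul : ∀ (c : F) M, Q M → Q (c • M) := by
    intro c M hM r
    rw [mul_smul_comm]
    exact hsmul _ _ (hM r)
  have hQleft : ∀ (r : F[X]) M, Q M → Q (aeval A r * M) := by
    intro r M hM s
    rw [← mul_assoc, ← map_mul]
    exact hM _
  have hQA : ∀ M, Q M → Q (M * A) := by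
    intro M hM r
    have h1 : aeval A r * (M * A) = aeval A (X * r) * M - adMat A (aeval A r * M) := by
      rw [adMat_apply, map_mul, aeval_X]
      noncomm_ring
    rw [h1, map_sub, ← Module.AEval'.X_smul_of]
    exact N.sub_mem (hM _) (N.smul_mem _ (hM r))
  have hQright : ∀ (s : F[X]) M, Q M → Q (M * aeval A s) := by
    intro s M hM
    induction s using Polynomial.induction_on' with
    | add p q hp hq => rw [map_add, mul_add]; exact hQadd _ _ hp hq
    | monomial k c =>
      rw [aeval_monomial, ← Algebra.smul_def, mul_smul_comm]
      refine hQsmul _ _ ?_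
      induction k with
      | zero => simpa using hM
      | succ k ih => rw [pow_succ, ← mul_assoc]; exact hQA _ ih
  have hQvec : ∀ x y, Q (Matrix.vecMulVec x y) := by
    intro x y
    obtain ⟨r, rfl⟩ := exists_aeval_mulVec_eq hirr hdeg.ge hA hv x
    obtain ⟨s, rfl⟩ := exists_aeval_mulVec_eq hirr hdeg.ge hAt hv y
    rw [← transpose_aeval, Matrix.mulVec_transpose, ← Matrix.vecMulVec_mul, ← Matrix.mul_vecMulVec]
    exact hQright _ _ (hQleft _ _ hQB)
  have hQall : ∀ M, Q M := by
    intro M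
    induction M using Matrix.induction_on' with
    | h_zero => intro r; rw [mul_zero, map_zero]; exact N.zero_mem
    | h_add p q hp hq => exact hQadd _ _ hp hq
    | h_std_basis i j x =>
      rw [← mul_one x, ← smul_eq_mul, ← Matrix.smul_single, Matrix.single_eq_single_vecMulVec_single]
      exact hQsmul _ _ (hQvec _ _)
  refine eq_top_iff.2 fun M _ => ?_
  have := hQall ((Module.AEval'.of (adMat A)).symm M) 1
  rwa [map_one, one_mul, LinearEquiv.apply_symm_apply] at this

/-- The `m` generators give a surjection from `(F[X]/(f))^m`; both sides have dimension `m^2`, so it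
is bijective. -/
theorem nonempty_aeval'_equiv (hirr : Irreducible h) (hmon : h.Monic) (hdeg : h.natDegree = m)
    (hA : aeval A h = 0) {f : F[X]} (hf : f.natDegree = m) (had : aeval (adMat A) f = 0) :
    Nonempty (Module.AEval' (adMat A) ≃ₗ[F[X]] (Fin m → F[X] ⧸ Ideal.span {f})) := by
  obtain ⟨B, hB⟩ := exists_span_pow_mul_eq_top hirr hmon hdeg hA
  set x : Fin m → Module.AEval' (adMat A) :=
    fun i => Module.AEval'.of (adMat A) (A ^ (i : ℕ) * B) with hx
  have hann : ∀ i, Ideal.span {f} ≤ LinearMap.ker (LinearMap.toSpanSingleton F[X] _ (x i)) := by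
    intro i
    rw [Ideal.span_le, Set.singleton_subset_iff]
    change f • x i = 0
    rw [hx, ← Module.AEval.of_aeval_smul, had, zero_smul, map_zero]
  set Φ : (Fin m → F[X] ⧸ Ideal.span {f}) →ₗ[F[X]] Module.AEval' (adMat A) :=
    LinearMap.lsum F[X] _ F[X] fun i => (Ideal.span {f}).liftQ _ (hann i) with hΦ
  have hsurj : Function.Surjective Φ := by
    rw [← LinearMap.range_eq_top, eq_top_iff, ← hB, Submodule.span_le]
    rintro _ ⟨i, rfl⟩
    refine ⟨Pi.single i (Submodule.Quotient.mk 1), ?_⟩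
    rw [hΦ, LinearMap.lsum_piSingle, Submodule.liftQ_apply, LinearMap.toSpanSingleton_apply,
      one_smul]
  have hfin : Module.Finite F (F[X] ⧸ Ideal.span {f}) :=
    (AdjoinRoot.powerBasis (ne_zero_of_natDegree_gt (n := 0) (by
      rw [hf, ← hdeg]; exact hirr.natDegree_pos))).finite
  have hrank : Module.finrank F (Fin m → F[X] ⧸ Ideal.span {f}) =
      Module.finrank F (Module.AEval' (adMat A)) := by
    rw [← (Module.AEval'.of (adMat A)).finrank_eq, Module.finrank_matrix, Module.finrank_pi_fintype]
    simp [finrank_quotient_span_eq_natDegree, hf]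
  have hinj : Function.Injective (Φ.restrictScalars F) :=
    (LinearMap.injective_iff_surjective_of_finrank_eq_finrank hrank).2 hsurj
  exact ⟨(LinearEquiv.ofBijective Φ ⟨hinj, hsurj⟩).symm⟩

end Bimodule

/-! ### The converse implication and the structure of `ad A`. -/

namespace IsGenArtinSchreier

variable {F : Type*} [Field F] {m : ℕ} {A : Matrix (Fin m) (Fin m) F} {p : ℕ} {h q : F[X]}
  {e n : ℕ} {a : F} {K : Subfield F}

theorem irreducible_sepPart (H : IsGenArtinSchreier A p h q e n a K) : Irreducible q := by
  have hirr := H.irreducible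
  rw [H.sepPart.expand_eq] at hirr
  exact of_irreducible_expand_pow H.prime.ne_zero hirr

theorem eq_X_pow_sub (H : IsGenArtinSchreier A p h q e n a K) :
    h = X ^ p ^ (n + e) - X ^ p ^ e - C a := by
  rw [H.sepPart.expand_eq, H.q_eq, map_sub, map_sub, map_pow, expand_X, expand_C, ← pow_mul,
    ← pow_add, add_comm]

theorem pow_lt_pow (H : IsGenArtinSchreier A p h q e n a K) : p ^ e < p ^ (n + e) :=
  Nat.pow_lt_pow_right H.prime.one_lt (by have := H.one_le; omega)

theorem monic_X_pow_sub (H : IsGenArtinSchreier A p h q e n a K) :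
    (X ^ p ^ (n + e) - X ^ p ^ e : F[X]).Monic :=
  Polynomial.monic_X_pow_sub (by rw [degree_X_pow]; exact_mod_cast H.pow_lt_pow)

theorem natDegree_X_pow_sub (H : IsGenArtinSchreier A p h q e n a K) :
    (X ^ p ^ (n + e) - X ^ p ^ e : F[X]).natDegree = p ^ (n + e) := by
  rw [natDegree_sub_eq_left_of_natDegree_lt, natDegree_X_pow]
  rw [natDegree_X_pow, natDegree_X_pow]
  exact H.pow_lt_pow

theorem dim_eq (H : IsGenArtinSchreier A p h q e n a K) : m = p ^ (n + e) := by
  rw [← H.natDegree_eq, H.eq_X_pow_sub, natDegree_sub_C, H.natDegree_X_pow_sub]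

theorem aeval_eq_zero (H : IsGenArtinSchreier A p h q e n a K) : aeval A h = 0 :=
  aeval_eq_zero_of_matSimilar H.monic H.natDegree_eq H.similar

theorem aeval_adMat (H : IsGenArtinSchreier A p h q e n a K) :
    aeval (adMat A) (X ^ p ^ (n + e) - X ^ p ^ e : F[X]) = 0 := by
  have : Fact p.Prime := ⟨H.prime⟩
  have := H.charP
  have h1 := H.aeval_eq_zero
  rw [H.eq_X_pow_sub, map_sub, map_sub, map_pow, map_pow, aeval_X, aeval_C] at h1
  refine LinearMap.ext fun B => ?_
  have h2 : (A ^ p ^ (n + e) - A ^ p ^ e) * B = B * (A ^ p ^ (n + e) - A ^ p ^ e) := by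
    rw [sub_eq_zero.1 h1, Algebra.commutes]
  rw [map_sub, map_pow, map_pow, aeval_X, LinearMap.sub_apply, adMat_pow_apply, adMat_pow_apply,
    LinearMap.zero_apply]
  rw [sub_mul, mul_sub, ← sub_eq_zero] at h2
  rw [← h2]
  abel

theorem adMat_pow_eq (H : IsGenArtinSchreier A p h q e n a K) :
    adMat A ^ p ^ (n + e) = adMat A ^ p ^ e := by
  have h1 := H.aeval_adMat
  rwa [map_sub, map_pow, map_pow, aeval_X, sub_eq_zero] at h1

/-- Injectivity of Frobenius reduces the equation to `μ^(p^n) = μ`, whose solutions are already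
exhausted by `K`. Allowing any extension `L` covers eigenvalues in the closure too. -/
theorem exists_mem_of_pow_eq_pow (H : IsGenArtinSchreier A p h q e n a K) {L : Type*} [Field L]
    [Algebra F L] {μ : L} (hμ : μ ^ p ^ (n + e) = μ ^ p ^ e) :
    ∃ c ∈ K, algebraMap F L c = μ := by
  have : Fact p.Prime := ⟨H.prime⟩
  have := H.charP
  have : CharP L p := charP_of_injective_algebraMap (algebraMap F L).injective p
  have h1 : μ ^ p ^ n = μ :=
    iterateFrobenius_inj L p e (by rw [iterateFrobenius_def, iterateFrobenius_def, ← pow_mul,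
      ← pow_add, hμ])
  obtain ⟨s, hs, hprod⟩ := Subfield.prod_X_sub_C_eq H.prime H.card_eq
  have h2 := congrArg (aeval μ) hprod
  rw [map_prod, map_sub, map_pow, aeval_X, h1, sub_self, Finset.prod_eq_zero_iff] at h2
  obtain ⟨c, hc, h3⟩ := h2
  rw [map_sub, aeval_X, aeval_C, sub_eq_zero] at h3
  exact ⟨c, (hs c).1 hc, h3.symm⟩

theorem allEigenvaluesIn (H : IsGenArtinSchreier A p h q e n a K) :
    AllEigenvaluesIn (adMat A) := by
  intro μ hμ
  have h1 := congrArg (Module.End.baseChangeHom F (AlgebraicClosure F) _) H.adMat_pow_eq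
  rw [map_pow, map_pow] at h1
  obtain ⟨c, -, hc⟩ := H.exists_mem_of_pow_eq_pow (pow_eq_pow_of_hasEigenvalue h1 hμ)
  exact ⟨c, hc⟩

theorem mem_of_hasEigenvalue (H : IsGenArtinSchreier A p h q e n a K) {c : F}
    (hc : (adMat A).HasEigenvalue c) : c ∈ K := by
  obtain ⟨d, hd, rfl⟩ := H.exists_mem_of_pow_eq_pow (pow_eq_pow_of_hasEigenvalue H.adMat_pow_eq hc)
  exact hd

theorem pos (H : IsGenArtinSchreier A p h q e n a K) : 0 < m :=
  H.natDegree_eq ▸ H.irreducible.natDegree_pos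

theorem aeval_add_algebraMap_eq_zero (H : IsGenArtinSchreier A p h q e n a K) {c : F}
    (hc : c ∈ K) : aeval (A + algebraMap F _ c) h = 0 := by
  have : Fact p.Prime := ⟨H.prime⟩
  have := H.charP
  have h1 : h.comp (X + C c) = h := by
    rw [H.eq_X_pow_sub]
    simp only [sub_comp, pow_comp, X_comp, C_comp]
    rw [add_pow_char_pow, add_pow_char_pow, ← C_pow, ← C_pow, pow_add p, pow_mul c,
      Subfield.pow_natCard_eq H.prime H.card_eq hc]
    ring
  rw [aeval_add_algebraMap, h1, H.aeval_eq_zero]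

/-- `A` and `A + c` are both killed by `h`, hence similar; a conjugating matrix is an eigenvector.
-/
theorem exists_isUnit_hasEigenvector (H : IsGenArtinSchreier A p h q e n a K) {c : F}
    (hc : c ∈ K) : ∃ B, IsUnit B ∧ (adMat A).HasEigenvector c B := by
  have : Nonempty (Fin m) := ⟨⟨0, H.pos⟩⟩
  obtain ⟨B, hB, hAB⟩ := exists_isUnit_mul_eq_mul H.irreducible H.monic H.natDegree_eq
    (H.aeval_add_algebraMap_eq_zero hc) H.aeval_eq_zero
  exact ⟨B, hB, Module.End.mem_eigenspace_iff.2 ((adMat_apply_eq_smul_iff A B c).2 hAB), hB.ne_zero⟩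

theorem hasEigenvalue_iff (H : IsGenArtinSchreier A p h q e n a K) {c : F} :
    (adMat A).HasEigenvalue c ↔ c ∈ K := by
  refine ⟨H.mem_of_hasEigenvalue, fun hc => ?_⟩
  obtain ⟨B, -, hB⟩ := H.exists_isUnit_hasEigenvector hc
  exact Module.End.hasEigenvalue_of_hasEigenvector hB

theorem eigenvalueSet_eq (H : IsGenArtinSchreier A p h q e n a K) :
    eigenvalueSet (adMat A) = (K : Set F) :=
  Set.ext fun _ => H.hasEigenvalue_iff

theorem isUnit_of_hasEigenvector (H : IsGenArtinSchreier A p h q e n a K) {c : F}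
    {B : Matrix (Fin m) (Fin m) F} (hB : (adMat A).HasEigenvector c B) : IsUnit B :=
  isUnit_of_mul_eq_mul H.irreducible H.natDegree_eq.ge (H.aeval_add_algebraMap_eq_zero
    (H.mem_of_hasEigenvalue (Module.End.hasEigenvalue_of_hasEigenvector hB))) hB.2
    ((adMat_apply_eq_smul_iff A B c).1 hB.apply_eq_smul)

/-- Nonzero members of the eigenspace are invertible, so evaluation at `v` embeds it in `F^m`;
conversely the `A^i B` are `m` independent members. -/
theorem finrank_eigenspace (H : IsGenArtinSchreier A p h q e n a K) {c : F}
    (hc : (adMat A).HasEigenvalue c) :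
    Module.finrank F ((adMat A).eigenspace c) = p ^ (n + e) := by
  obtain ⟨v, hv⟩ : ∃ v : Fin m → F, v ≠ 0 := ⟨Pi.single ⟨0, H.pos⟩ 1, by simp⟩
  obtain ⟨B, hBu, hB⟩ := H.exists_isUnit_hasEigenvector (H.mem_of_hasEigenvalue hc)
  rw [← H.dim_eq]
  apply le_antisymm
  · have hinj : Function.Injective
        ((Matrix.mulVecBilin F F).flip v ∘ₗ ((adMat A).eigenspace c).subtype) := by
      rw [← LinearMap.ker_eq_bot, LinearMap.ker_eq_bot']
      rintro ⟨M, hM⟩ hMv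
      refine Subtype.ext ?_
      by_contra hne
      have hu := H.isUnit_of_hasEigenvector ⟨hM, hne⟩
      exact hv (Matrix.mulVec_injective_of_isUnit hu (hMv.trans (Matrix.mulVec_zero M).symm))
    simpa using LinearMap.finrank_le_finrank_of_injective hinj
  · have hAB := (adMat_apply_eq_smul_iff A B c).1 hB.apply_eq_smul
    have hmem : ∀ i : Fin m, A ^ (i : ℕ) * B ∈ (adMat A).eigenspace c := by
      intro i
      rw [Module.End.mem_eigenspace_iff, adMat_apply_eq_smul_iff, ← mul_assoc,
        (Commute.self_pow A i).eq, mul_assoc, hAB, mul_assoc]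
    have hli : LinearIndependent F
        (fun i : Fin m => (⟨A ^ (i : ℕ) * B, hmem i⟩ : (adMat A).eigenspace c)) := by
      have hBv : B.mulVec v ≠ 0 := fun h0 =>
        hv (Matrix.mulVec_injective_of_isUnit hBu (h0.trans (Matrix.mulVec_zero B).symm))
      refine LinearIndependent.of_comp
        ((Matrix.mulVecBilin F F).flip v ∘ₗ ((adMat A).eigenspace c).subtype) ?_
      have h1 :=
        linearIndependent_pow_mulVec H.irreducible H.natDegree_eq.ge H.aeval_eq_zero hBv
      simp only [Matrix.mulVec_mulVec] at h1
      exact h1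
    simpa using hli.fintype_card_le_finrank

theorem hasInvariantFactors (H : IsGenArtinSchreier A p h q e n a K) :
    HasInvariantFactors (adMat A)
      (fun _ : Fin (p ^ (n + e)) => (X ^ (p ^ (n + e)) - X ^ (p ^ e) : F[X])) where
  monic _ := H.monic_X_pow_sub
  natDegree_pos _ := by rw [H.natDegree_X_pow_sub, ← H.dim_eq]; exact H.pos
  dvd _ _ _ := dvd_rfl
  equiv := by
    have hm := H.dim_eq
    obtain ⟨E⟩ := nonempty_aeval'_equiv H.irreducible H.monic H.natDegree_eq H.aeval_eq_zero
      (H.natDegree_X_pow_sub.trans hm.symm) H.aeval_adMat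
    exact ⟨E.trans (LinearEquiv.funCongrLeft F[X] _ (finCongr hm.symm))⟩

theorem minpoly_adMat (H : IsGenArtinSchreier A p h q e n a K) :
    minpoly F (adMat A) = X ^ (p ^ (n + e)) - X ^ (p ^ e) := by
  obtain ⟨E⟩ := H.hasInvariantFactors.equiv
  have hpos : 0 < p ^ (n + e) := H.dim_eq ▸ H.pos
  refine eq_of_monic_of_associated (minpoly.monic (Algebra.IsIntegral.isIntegral _))
    H.monic_X_pow_sub (associated_of_dvd_dvd (minpoly.dvd F _ H.aeval_adMat) ?_)
  have h0 : ∀ x : Module.AEval' (adMat A), minpoly F (adMat A) • x = 0 := by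
    intro x
    obtain ⟨M, rfl⟩ := (Module.AEval'.of (adMat A)).surjective x
    rw [← Module.AEval.of_aeval_smul, minpoly.aeval, zero_smul, map_zero]
  -- A polynomial killing the class of `1` in a cyclic factor is divisible by the invariant factor.
  have h1 := h0 (E.symm fun _ => Ideal.Quotient.mk _ 1)
  rw [← map_smul, LinearEquiv.map_eq_zero_iff] at h1
  have h2 := congrFun h1 ⟨0, hpos⟩
  rw [← Ideal.mem_span_singleton, ← Ideal.Quotient.eq_zero_iff_mem]
  rw [Pi.smul_apply, ← Ideal.Quotient.mk_eq_mk, ← Submodule.Quotient.mk_smul, smul_eq_mul,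
    mul_one] at h2
  exact h2

/-- Diagonalizability makes `X^(p^n) - X` kill `ad A`, and the degree of the minimal polynomial then
forces `e = 0`. For `e = 0` the annihilator is a product of distinct linear factors. -/
theorem isDiagonalizableEnd_iff (H : IsGenArtinSchreier A p h q e n a K) :
    IsDiagonalizableEnd (adMat A) ↔ e = 0 := by
  constructor
  · rintro ⟨s, b, hb⟩
    have h1 : aeval (adMat A) (X ^ p ^ n - X : F[X]) = 0 := by
      refine b.ext fun i => ?_
      obtain ⟨c, hc⟩ := hb i
      have hv : (adMat A).HasEigenvector c (b i) :=
        ⟨Module.End.mem_eigenspace_iff.2 hc, b.ne_zero i⟩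
      have hcK := H.mem_of_hasEigenvalue (Module.End.hasEigenvalue_of_hasEigenvector hv)
      rw [Module.End.aeval_apply_of_hasEigenvector hv]
      simp [Subfield.pow_natCard_eq H.prime H.card_eq hcK]
    have hpn : 1 < p ^ n := Nat.one_lt_pow (by have := H.one_le; omega) H.prime.one_lt
    have h2 := natDegree_le_of_dvd (minpoly.dvd F _ h1) (FiniteField.X_pow_card_sub_X_ne_zero F hpn)
    rw [H.minpoly_adMat, H.natDegree_X_pow_sub, FiniteField.X_pow_card_sub_X_natDegree_eq _ hpn,
      Nat.pow_le_pow_iff_right H.prime.one_lt] at h2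
    omega
  · rintro rfl
    obtain ⟨s, -, hprod⟩ := Subfield.prod_X_sub_C_eq H.prime H.card_eq
    refine isDiagonalizableEnd_of_span_eq_top (eq_top_iff.2 ?_)
    refine le_trans ?_ (ker_aeval_prod_le_span (adMat A) s)
    have h1 := H.aeval_adMat
    rw [add_zero, pow_zero, pow_one] at h1
    rw [hprod, h1, LinearMap.ker_zero]

theorem separable_iff (H : IsGenArtinSchreier A p h q e n a K) : h.Separable ↔ e = 0 := by
  have := H.charP
  constructor
  · intro hs
    by_contra he
    rw [separable_iff_derivative_ne_zero H.irreducible] at hs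
    refine hs ?_
    rw [H.eq_X_pow_sub]
    simp [derivative_X_pow, he]
  · rintro rfl
    rw [H.sepPart.expand_eq, pow_zero, expand_one]
    exact H.sepPart.separable

end IsGenArtinSchreier

theorem theorem1 {F : Type*} [Field F] {m : ℕ} (A : Matrix (Fin m) (Fin m) F) :
    ((AllEigenvaluesIn (adMat A) ∧
        (∃ S : Subfield F, (S : Set F) = eigenvalueSet (adMat A)) ∧
        IsField (Subalgebra.centralizer F ({A} : Set (Matrix (Fin m) (Fin m) F)))) ↔
      ∃ (p : ℕ) (h q : F[X]) (e n : ℕ) (a : F) (K : Subfield F),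
        IsGenArtinSchreier A p h q e n a K) ∧
    ∀ (p : ℕ) (h q : F[X]) (e n : ℕ) (a : F) (K : Subfield F),
      IsGenArtinSchreier A p h q e n a K →
        Irreducible q ∧
        eigenvalueSet (adMat A) = (K : Set F) ∧
        (∀ (b : F) (B : Matrix (Fin m) (Fin m) F),
          Module.End.HasEigenvector (adMat A) b B → IsUnit B) ∧
        (∀ b : F, Module.End.HasEigenvalue (adMat A) b →
          Module.finrank F (Module.End.eigenspace (adMat A) b) = p ^ (n + e)) ∧
        (IsDiagonalizableEnd (adMat A) ↔ h.Separable) ∧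
        (IsDiagonalizableEnd (adMat A) ↔ e = 0) ∧
        HasInvariantFactors (adMat A)
          (fun _ : Fin (p ^ (n + e)) => (X ^ (p ^ (n + e)) - X ^ (p ^ e) : F[X])) ∧
        minpoly F (adMat A) = X ^ (p ^ (n + e)) - X ^ (p ^ e) := by
  refine ⟨⟨fun ⟨h1, h2, h3⟩ => exists_isGenArtinSchreier h1 h2 h3, ?_⟩, ?_⟩
  · rintro ⟨p, h, q, e, n, a, K, H⟩
    exact ⟨H.allEigenvaluesIn, ⟨K, H.eigenvalueSet_eq.symm⟩,
      isField_centralizer H.irreducible H.natDegree_eq H.aeval_eq_zero⟩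
  · intro p h q e n a K H
    exact ⟨H.irreducible_sepPart, H.eigenvalueSet_eq, fun _ _ hB => H.isUnit_of_hasEigenvector hB,
      fun _ hb => H.finrank_eigenspace hb, H.isDiagonalizableEnd_iff.trans H.separable_iff.symm,
      H.isDiagonalizableEnd_iff, H.hasInvariantFactors, H.minpoly_adMat⟩
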